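/- Let $\Gamma$ be a (simple, undirected) graph on $k$ nodes and let $n>k$. Let $\mathfrak{G}$ be a random graph on $n$ nodes, labeled so that the leading $k\times k$ principal minor of its adjacency matrix $A_{\mathfrak G}$ is the adjacency matrix $A_\Gamma$, and whose remaining edges follow the Erdős–Rényi model: the pairs $\{i,j\}$ with $1\le i<j\le n$ and $j>k$ are edges of $\mathfrak G$ independently, each with probability $p$. Let $\mathcal E\subseteq\mathbb R^k$ be an eigenspace of $A_\Gamma$, and let $\mathcal P_{\mathcal E}$ be the matrix of the orthogonal projection onto $\mathcal E$. Let $\mathrm{krank}(\mathcal E)$ be the largest integer $m\le k$ such that for every $\Omega\subseteq\{1,\dots,k\}$ with $|\Omega|=m$ we have $\mathcal E^\perp\cap\{v\in\mathbb R^k: v_i=0 \text{ for } i\notin\Omega\}=\{0\}$. Suppose that $0\le p<\mathrm{krank}(\mathcal E)/k$, and let $\ell$ be an integer with $kp<\ell\le\mathrm{krank}(\mathcal E)$. For $\Omega\subseteq\{1,\dots,k\}$ with $|\Omega|\le\ell$, let $q_\Omega$ be the vector of minimum Euclidean norm among all $q\in\mathcal E$ with $q_i=1$ for all $i\in\Omega$.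 Let $$\omega:=\Big\|\,\mathbb E\big[q_\Omega q_\Omega'\,\big|\,|\Omega|\le\ell\big]\Big\|_2,$$ where each element of $\{1,\dots,k\}$ belongs to the random set $\Omega$ independently with probability $p$, and let $$\zeta:=\min_{\emptyset\ne\Omega\subseteq\{1,\dots,k\},\ |\Omega|\le\ell}\lambda_{\min}\big((\mathcal P_{\mathcal E})_{\Omega,\Omega}\big).$$ Then for every $\delta\ge\sqrt{(n-k)\,\omega}$, with probability at least $$\Big(1-2k\exp\Big(-\frac{3\,\zeta\,(\delta^2-(n-k)\,\omega)^2}{4\,\ell\,(\delta^2+2(n-k)\,\omega)}\Big)\Big)\Big(1-\exp\Big(-\frac{(\ell-kp)^2}{\ell+kp}\Big)\Big)^{n-k}$$ there exists a matrix $M_{12}\in\mathbb R^{k\times(n-k)}$ such that (1) each column of $M_{12}$ lies in $\mathcal E$; (2) $(M_{12})_{i,j}=(A_{\mathfrak G})_{i,j+k}$ whenever $(A_{\mathfrak G})_{i,j+k}=1$; and (3) the spectral norm satisfies $\|M_{12}\|_2<\delta$. (If $\delta=\omega=0$, the quotient $0/0$ in the first exponent is read as $0$, and the bound is then not positive.)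 -/

import Mathlib

open MeasureTheory ProbabilityTheory
open scoped Matrix.Norms.L2Operator

namespace PlantedSubgraph

/-- The Kruskal rank of a subspace `S` of `ℝᵏ`: the largest `m ≤ k` such that, for every set `Ω` of
`m` coordinates, the only vector supported on `Ω` and orthogonal to `S` is `0`. -/
noncomputable def krank {k : ℕ} (S : Submodule ℝ (EuclideanSpace ℝ (Fin k))) : ℕ :=
  sSup {m : ℕ | m ≤ k ∧ ∀ Ω : Finset (Fin k), Ω.card = m →
    ∀ v : EuclideanSpace ℝ (Fin k), v ∈ Sᗮ → (∀ i, i ∉ Ω → v i = 0) → v = 0}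

/-- The matrix of the orthogonal projection of `ℝᵏ` onto `S`, in the standard basis. -/
noncomputable def projMatrix {k : ℕ} (S : Submodule ℝ (EuclideanSpace ℝ (Fin k))) :
    Matrix (Fin k) (Fin k) ℝ :=
  Matrix.of fun i j => (S.starProjection (EuclideanSpace.single j 1)) i

/-- The smallest eigenvalue of a real symmetric matrix (of positive size). -/
noncomputable def lambdaMin {ι : Type*} [Fintype ι] [DecidableEq ι] (A : Matrix ι ι ℝ) : ℝ :=
  sInf (spectrum ℝ A)

/-- The minimum, over the nonempty coordinate sets `Ω` with `|Ω| ≤ l`, of the smallest eigenvalue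
of the principal minor on `Ω` of the projection matrix onto `S`. -/
noncomputable def zeta {k : ℕ} (S : Submodule ℝ (EuclideanSpace ℝ (Fin k))) (l : ℕ) : ℝ :=
  sInf {x : ℝ | ∃ Ω : Finset (Fin k), Ω.Nonempty ∧ Ω.card ≤ l ∧
    x = lambdaMin ((projMatrix S).submatrix (fun i : Ω => (i : Fin k)) (fun j : Ω => (j : Fin k)))}

/-- The vectors of `S` whose entries on `Ω` are all equal to `1`. -/
def completions {k : ℕ} (S : Submodule ℝ (EuclideanSpace ℝ (Fin k))) (Ω : Finset (Fin k)) :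
    Set (EuclideanSpace ℝ (Fin k)) :=
  {q | q ∈ S ∧ ∀ i ∈ Ω, q i = 1}

open Classical in
/-- The minimum Euclidean-norm element of `completions S Ω` (it exists and is unique as soon as
`completions S Ω` is nonempty; the value is `0` otherwise). -/
noncomputable def minNormCompletion {k : ℕ} (S : Submodule ℝ (EuclideanSpace ℝ (Fin k)))
    (Ω : Finset (Fin k)) : EuclideanSpace ℝ (Fin k) :=
  if h : ∃ q ∈ completions S Ω, ∀ q' ∈ completions S Ω, ‖q‖ ≤ ‖q'‖ then h.choose else 0

/-- The probability that a random subset of `{1, …, k}`, containing each element independently with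
probability `p`, is equal to `Ω`. -/
def subsetWeight {k : ℕ} (p : ℝ) (Ω : Finset (Fin k)) : ℝ :=
  p ^ Ω.card * (1 - p) ^ (k - Ω.card)

/-- The conditional correlation matrix `𝔼[q_Ω q_Ω' | |Ω| ≤ l]` of the minimum-norm completions, for
a random subset `Ω` containing each coordinate independently with probability `p`. -/
noncomputable def condCorrelation {k : ℕ} (S : Submodule ℝ (EuclideanSpace ℝ (Fin k)))
    (l : ℕ) (p : ℝ) : Matrix (Fin k) (Fin k) ℝ :=
  (∑ Ω : Finset (Fin k) with Ω.card ≤ l, subsetWeight p Ω)⁻¹ •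
    ∑ Ω : Finset (Fin k) with Ω.card ≤ l, subsetWeight p Ω •
      Matrix.vecMulVec (fun i => minNormCompletion S Ω i) (fun i => minNormCompletion S Ω i)

/-- The combinatorial width of `S`: the spectral norm of the conditional correlation matrix. -/
noncomputable def combWidth {k : ℕ} (S : Submodule ℝ (EuclideanSpace ℝ (Fin k)))
    (l : ℕ) (p : ℝ) : ℝ :=
  ‖condCorrelation S l p‖

open Classical in
/-- The real adjacency matrix of a graph. -/
noncomputable def adj {V : Type*} (G : SimpleGraph V) : Matrix V V ℝ :=
  G.adjMatrix ℝ

/-- The node of the large graph that carries the `i`-th label of the planted graph. -/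
def coreNode {k n : ℕ} (h : k < n) (i : Fin k) : Fin n := Fin.castLE h.le i

/-- The `j`-th node of the large graph after the first `k` ones. -/
def outerNode {k n : ℕ} (h : k < n) (j : Fin (n - k)) : Fin n := ⟨k + j, by omega⟩

/-- `𝔊` is a random graph on `n` nodes in which `Γ` is planted on the first `k` nodes and all
other edges follow the Erdős–Rényi model: the pairs `i < j` with `j` not among the first `k` nodes
are edges independently, each with probability `p`. -/
structure IsPlantedErdosRenyi {k n : ℕ} (h : k < n) (Γ : SimpleGraph (Fin k)) (p : ℝ)
    {X : Type*} [MeasurableSpace X] (μ : Measure X) (𝔊 : X → SimpleGraph (Fin n)) : Prop where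
  planted : ∀ x, (adj (𝔊 x)).submatrix (coreNode h) (coreNode h) = adj Γ
  measurableSet_adj : ∀ i j, MeasurableSet {x | (𝔊 x).Adj i j}
  prob_adj : ∀ i j : Fin n, i < j → k ≤ (j : ℕ) → μ {x | (𝔊 x).Adj i j} = ENNReal.ofReal p
  indep : iIndepSet
    (fun e : {e : Fin n × Fin n // e.1 < e.2 ∧ k ≤ (e.2 : ℕ)} => {x | (𝔊 x).Adj e.1.1 e.1.2}) μ

end PlantedSubgraph

/-! Put `N = n - k` and let `Ω_j` be the set of core neighbors of the `j`-th outer node: `N`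
independent random subsets with law `subsetWeight p`. If every `|Ω_j| ≤ l`, take for `M` the matrix
with columns `q_{Ω_j}`; (1) and (2) hold by construction and only the norm is at stake. The size
condition has probability `Z ^ N`, where `Z` is the mass of the sets with at most `l` elements, and
a scalar Chernoff bound (`one_sub_exp_le_sum_subsetWeight`) controls `Z`.

Given the size condition, the columns are i.i.d., of squared length at most `R = l / ζ`
(`exists_completion`), with second moment matrix of norm `ω`. Their norm is bounded by a matrix
Chernoff argument (`sum_prod_ite_le_l2_opNorm_le`): Markov's inequality for `tr exp (θ M Mᵀ)`,
averaging over the columns one at a time. Each column costs a factor `1 + ω (exp (θ R) - 1) / R`, by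
the rank one Golden–Thompson inequality `PosSemidef.trace_exp_add_vecMulVec_le`. That inequality is
proved coefficient by coefficient in the exponential series, from Chebyshev's sum inequality on the
spectrum.

The argument yields the constant `k` where the theorem has `2k`. When `ζ ≤ 0` or `δ² = N ω`, the
claimed bound is not positive. -/

namespace Matrix

/-! ### Golden–Thompson inequality for a rank one perturbation. -/

variable {ι : Type*} [Fintype ι] [DecidableEq ι]

theorem dotProduct_conjStarAlgAut_diagonal_mulVec (U : unitaryGroup ι ℝ) (d v : ι → ℝ) :
    v ⬝ᵥ (Unitary.conjStarAlgAut ℝ _ U (diagonal d)) *ᵥ v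
      = ∑ i, d i * (((star U : unitaryGroup ι ℝ) : Matrix ι ι ℝ) *ᵥ v) i ^ 2 := by
  rw [Unitary.conjStarAlgAut_apply, ← mulVec_mulVec, ← mulVec_mulVec, dotProduct_mulVec,
    ← mulVec_transpose]
  simp only [dotProduct, mulVec_diagonal]
  refine Finset.sum_congr rfl fun i _ => ?_
  have : ((U : Matrix ι ι ℝ)ᵀ *ᵥ v) = ((star U : unitaryGroup ι ℝ) : Matrix ι ι ℝ) *ᵥ v := by
    rw [Unitary.coe_star, star_eq_conjTranspose, conjTranspose_eq_transpose_of_trivial]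
  rw [this, ← Unitary.coe_star]
  ring

omit [DecidableEq ι] in
-- Symmetrization: the double sum of `w i * w j * ((f i - f j) * (g i - g j))` is nonnegative and
-- equals twice the difference of the two sides.
theorem _root_.Finset.sum_mul_sum_le_of_monovary (w f g : ι → ℝ) (hw : ∀ i, 0 ≤ w i)
    (hfg : ∀ i j, 0 ≤ (f i - f j) * (g i - g j)) :
    (∑ i, f i * w i) * (∑ i, g i * w i) ≤ (∑ i, w i) * ∑ i, f i * g i * w i := by
  have h : 0 ≤ ∑ i, ∑ j, w i * w j * ((f i - f j) * (g i - g j)) :=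
    Finset.sum_nonneg fun i _ => Finset.sum_nonneg fun j _ =>
      mul_nonneg (mul_nonneg (hw i) (hw j)) (hfg i j)
  have e : ∑ i, ∑ j, w i * w j * ((f i - f j) * (g i - g j))
      = ∑ i, ∑ j, (f i * g i * w i) * w j - ∑ i, ∑ j, (f i * w i) * (g j * w j)
        - ∑ i, ∑ j, (g i * w i) * (f j * w j) + ∑ i, ∑ j, w i * (f j * g j * w j) := by
    simp only [← Finset.sum_sub_distrib, ← Finset.sum_add_distrib]
    refine Finset.sum_congr rfl fun i _ => Finset.sum_congr rfl fun j _ => by ring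
  rw [e] at h
  simp only [← Finset.sum_mul_sum] at h
  nlinarith

/-- A Chebyshev type inequality for moments of a positive semidefinite matrix. -/
theorem PosSemidef.dotProduct_pow_mul_dotProduct_le {A : Matrix ι ι ℝ} (hA : A.PosSemidef)
    (v : ι → ℝ) {b : ℝ} (hb : 0 ≤ b) (j i : ℕ) :
    (v ⬝ᵥ (A + b • 1) ^ j *ᵥ v) * (v ⬝ᵥ A ^ i *ᵥ v)
      ≤ (v ⬝ᵥ v) * (v ⬝ᵥ ((A + b • 1) ^ j * A ^ i) *ᵥ v) := by
  have hs := hA.1.spectral_theorem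
  set φ := Unitary.conjStarAlgAut ℝ _ hA.1.eigenvectorUnitary
  set d : ι → ℝ := hA.1.eigenvalues with hd
  have hd0 : ∀ x, 0 ≤ d x := hA.eigenvalues_nonneg
  have hs' : A = φ (diagonal d) := hs
  have h1 : A + b • 1 = φ (diagonal fun x => d x + b) := by
    have : (diagonal fun x => d x + b) = diagonal d + b • (1 : Matrix ι ι ℝ) := by
      rw [← diagonal_one, ← diagonal_smul, diagonal_add]; simp
    rw [this, map_add, map_smul, map_one, ← hs']
  have key : ∀ a c : ℕ, v ⬝ᵥ ((A + b • 1) ^ a * A ^ c) *ᵥ v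
      = ∑ x, ((d x + b) ^ a * d x ^ c)
        * (((star hA.1.eigenvectorUnitary : unitaryGroup ι ℝ) : Matrix ι ι ℝ) *ᵥ v) x ^ 2 := by
    intro a c
    rw [h1, show A ^ c = φ (diagonal d) ^ c by rw [← hs'], ← map_pow, ← map_pow, ← map_mul,
      diagonal_pow, diagonal_pow, diagonal_mul_diagonal,
      dotProduct_conjStarAlgAut_diagonal_mulVec]
    rfl
  have k1 := key j 0
  have k2 := key 0 i
  have k3 := key 0 0
  simp only [pow_zero, mul_one, one_mul, one_mulVec] at k1 k2 k3
  rw [k1, k2, k3, key j i]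
  refine Finset.sum_mul_sum_le_of_monovary _ _ _ (fun _ => sq_nonneg _) fun x y => ?_
  rcases le_total (d x) (d y) with h | h
  · refine mul_nonneg_of_nonpos_of_nonpos (sub_nonpos.2 ?_) (sub_nonpos.2 ?_)
    · exact pow_le_pow_left₀ (add_nonneg (hd0 x) hb) (by linarith) _
    · exact pow_le_pow_left₀ (hd0 x) h _
  · refine mul_nonneg (sub_nonneg.2 ?_) (sub_nonneg.2 ?_)
    · exact pow_le_pow_left₀ (add_nonneg (hd0 y) hb) (by linarith) _
    · exact pow_le_pow_left₀ (hd0 y) h _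

/-- Splitting off the factor next to `A ^ i` sends `(j + 1, i)` to `(j, i + 1)` on both sides, plus
a correction: `(vᵀAⁱv)(vᵀ(A + vvᵀ)ʲv)` on the left, `|v|² vᵀ(A + |v|²)ʲAⁱv` on the right. The
induction hypothesis at `i = 0` and the Chebyshev inequality compare the corrections. -/
theorem PosSemidef.dotProduct_add_vecMulVec_pow_le {A : Matrix ι ι ℝ} (hA : A.PosSemidef)
    (v : ι → ℝ) (j i : ℕ) :
    v ⬝ᵥ ((A + vecMulVec v v) ^ j * A ^ i) *ᵥ v
      ≤ v ⬝ᵥ ((A + (v ⬝ᵥ v) • 1) ^ j * A ^ i) *ᵥ v := by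
  have hb : 0 ≤ v ⬝ᵥ v := by simpa using dotProduct_star_self_nonneg v
  induction j generalizing i with
  | zero => simp
  | succ j ih =>
    have ha : 0 ≤ v ⬝ᵥ A ^ i *ᵥ v := by
      simpa using (hA.pow i).dotProduct_mulVec_nonneg v
    have e1 : v ⬝ᵥ ((A + vecMulVec v v) ^ (j + 1) * A ^ i) *ᵥ v
        = v ⬝ᵥ ((A + vecMulVec v v) ^ j * A ^ (i + 1)) *ᵥ v
          + (v ⬝ᵥ A ^ i *ᵥ v) * (v ⬝ᵥ ((A + vecMulVec v v) ^ j * A ^ 0) *ᵥ v) := by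
      rw [pow_succ, mul_assoc, add_mul, mul_add, ← pow_succ', add_mulVec, dotProduct_add]
      congr 1
      rw [← mulVec_mulVec, ← mulVec_mulVec, vecMulVec_mulVec]
      simp [mulVec_smul]
    have e2 : v ⬝ᵥ ((A + (v ⬝ᵥ v) • 1) ^ (j + 1) * A ^ i) *ᵥ v
        = v ⬝ᵥ ((A + (v ⬝ᵥ v) • 1) ^ j * A ^ (i + 1)) *ᵥ v
          + (v ⬝ᵥ v) * (v ⬝ᵥ ((A + (v ⬝ᵥ v) • 1) ^ j * A ^ i) *ᵥ v) := by
      rw [pow_succ, mul_assoc, add_mul, mul_add, ← pow_succ', add_mulVec, dotProduct_add]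
      congr 1
      simp [smul_mulVec]
    rw [e1, e2]
    have h3 := hA.dotProduct_pow_mul_dotProduct_le v hb j i
    have h4 := mul_le_mul_of_nonneg_left (ih 0) ha
    have h5 := ih (i + 1)
    simp only [pow_zero, mul_one] at h4 ⊢
    linarith

omit [DecidableEq ι] in
theorem trace_mul_vecMulVec_mul (X Y : Matrix ι ι ℝ) (v : ι → ℝ) :
    (X * vecMulVec v v * Y).trace = v ⬝ᵥ (Y * X) *ᵥ v := by
  rw [mul_assoc, trace_mul_comm, mul_assoc, trace_mul_comm, mul_vecMulVec, trace_vecMulVec,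
    dotProduct_comm]

/-- Telescoping turns each difference of `m`-th powers into `m` terms, which the previous bound
compares one by one. On the left, cyclicity of the trace produces quadratic forms in `v`; on the
right, `A` commutes with `A + |v|²`. -/
theorem PosSemidef.trace_add_vecMulVec_pow_le {A : Matrix ι ι ℝ} (hA : A.PosSemidef)
    (v : ι → ℝ) (m : ℕ) :
    (v ⬝ᵥ v) * (((A + vecMulVec v v) ^ m).trace - (A ^ m).trace)
      ≤ v ⬝ᵥ ((A + (v ⬝ᵥ v) • 1) ^ m - A ^ m) *ᵥ v := by
  have hb : 0 ≤ v ⬝ᵥ v := by simpa using dotProduct_star_self_nonneg v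
  have e1 : ∀ m, ((A + vecMulVec v v) ^ m).trace - (A ^ m).trace
      = ∑ i ∈ Finset.range m, v ⬝ᵥ ((A + vecMulVec v v) ^ (m - 1 - i) * A ^ i) *ᵥ v := by
    intro m
    have : ∀ m, (A + vecMulVec v v) ^ m - A ^ m
      = ∑ i ∈ Finset.range m, A ^ i * vecMulVec v v * (A + vecMulVec v v) ^ (m - 1 - i) := by
      intro m
      induction m with
      | zero => simp
      | succ m ih =>
        rw [Finset.sum_range_succ', pow_succ', pow_succ']
        have : ∑ i ∈ Finset.range m, A ^ (i + 1) * vecMulVec v v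
            * (A + vecMulVec v v) ^ (m + 1 - 1 - (i + 1))
            = A * ((A + vecMulVec v v) ^ m - A ^ m) := by
          rw [ih, Finset.mul_sum]
          refine Finset.sum_congr rfl fun i _ => ?_
          rw [pow_succ', show m + 1 - 1 - (i + 1) = m - 1 - i by omega]
          simp only [mul_assoc]
        rw [this]
        simp only [Nat.add_sub_cancel, Nat.sub_zero, pow_zero, one_mul]
        noncomm_ring
    rw [← trace_sub, this, trace_sum]
    exact Finset.sum_congr rfl fun i _ => trace_mul_vecMulVec_mul _ _ _
  have e2 : (A + (v ⬝ᵥ v) • 1) ^ m - A ^ m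
      = (v ⬝ᵥ v) • ∑ i ∈ Finset.range m, (A + (v ⬝ᵥ v) • 1) ^ (m - 1 - i) * A ^ i := by
    have hc : Commute A (A + (v ⬝ᵥ v) • 1) :=
      (Commute.refl A).add_right ((Commute.one_right A).smul_right _)
    have h := hc.mul_geom_sum₂ m
    have h2 := hc.geom_sum₂_comm m
    rw [← neg_inj, neg_sub, ← h]
    rw [show A - (A + (v ⬝ᵥ v) • 1) = -((v ⬝ᵥ v) • (1 : Matrix ι ι ℝ)) by abel, neg_mul,
      smul_mul_assoc, one_mul]
    congr 2
    exact Finset.sum_congr rfl fun i _ => (hc.pow_pow _ _)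
  rw [e1, e2, smul_mulVec, dotProduct_smul, smul_eq_mul, sum_mulVec, dotProduct_sum]
  exact mul_le_mul_of_nonneg_left
    (Finset.sum_le_sum fun i _ => hA.dotProduct_add_vecMulVec_pow_le v _ _) hb

theorem hasSum_trace_exp (A : Matrix ι ι ℝ) :
    HasSum (fun m : ℕ => ((m.factorial : ℝ))⁻¹ * (A ^ m).trace) (NormedSpace.exp A).trace := by
  have h := NormedSpace.exp_series_hasSum_exp' (𝕂 := ℝ) A
  have := h.map (traceAddMonoidHom ι ℝ)
    (LinearMap.continuous_of_finiteDimensional (traceLinearMap ι ℝ ℝ))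
  simpa [Function.comp_def] using this

theorem hasSum_dotProduct_exp (A : Matrix ι ι ℝ) (v : ι → ℝ) :
    HasSum (fun m : ℕ => ((m.factorial : ℝ))⁻¹ * (v ⬝ᵥ (A ^ m) *ᵥ v))
      (v ⬝ᵥ (NormedSpace.exp A) *ᵥ v) := by
  have h := NormedSpace.exp_series_hasSum_exp' (𝕂 := ℝ) A
  let f : Matrix ι ι ℝ →ₗ[ℝ] ℝ :=
    { toFun := fun X => v ⬝ᵥ X *ᵥ v
      map_add' := fun X Y => by rw [add_mulVec, dotProduct_add]
      map_smul' := fun c X => by simp [smul_mulVec] }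
  have := h.map f (LinearMap.continuous_of_finiteDimensional f)
  simpa [Function.comp_def, f, smul_mulVec] using this

theorem exp_add_smul_one (A : Matrix ι ι ℝ) (b : ℝ) :
    NormedSpace.exp (A + b • 1) = Real.exp b • NormedSpace.exp A := by
  rw [exp_add_of_commute _ _ ((Commute.one_right A).smul_right _), ← diagonal_one,
    ← diagonal_smul, exp_diagonal]
  have : NormedSpace.exp (b • fun _ : ι => (1 : ℝ)) = fun _ => Real.exp b := by
    funext i
    rw [Pi.coe_exp, Real.exp_eq_exp_ℝ]
    simp
  rw [this]
  ext i j
  simp [mul_diagonal, mul_comm]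

/-- The Golden–Thompson inequality for a positive semidefinite matrix and a rank one matrix. -/
theorem PosSemidef.trace_exp_add_vecMulVec_le {A : Matrix ι ι ℝ} (hA : A.PosSemidef)
    (v : ι → ℝ) :
    (v ⬝ᵥ v) * ((NormedSpace.exp (A + vecMulVec v v)).trace - (NormedSpace.exp A).trace)
      ≤ (Real.exp (v ⬝ᵥ v) - 1) * (v ⬝ᵥ NormedSpace.exp A *ᵥ v) := by
  have h1 := ((hasSum_trace_exp (A + vecMulVec v v)).sub (hasSum_trace_exp A)).mul_left (v ⬝ᵥ v)
  have h2 := (hasSum_dotProduct_exp (A + (v ⬝ᵥ v) • 1) v).sub (hasSum_dotProduct_exp A v)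
  have := hasSum_le (fun m => ?_) h1 h2
  · rw [exp_add_smul_one, smul_mulVec, dotProduct_smul, smul_eq_mul] at this
    linarith
  · rw [← mul_sub, ← mul_sub, ← mul_assoc, mul_comm (v ⬝ᵥ v), mul_assoc, ← dotProduct_sub,
      ← sub_mulVec]
    exact mul_le_mul_of_nonneg_left (hA.trace_add_vecMulVec_pow_le v m) (by positivity)

end Matrix

/-! ### Matrix Chernoff bound through the trace of the exponential. -/

namespace Matrix

variable {ι : Type*} [Fintype ι] [DecidableEq ι]

/-- The factor is `exp (A / 2)`. It makes `vᵀ exp(A) v` a sum of squares of linear forms in `v`, to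
which a second moment bound applies. -/
theorem IsHermitian.exp_eq_mul_transpose {A : Matrix ι ι ℝ} (hA : A.IsHermitian) :
    ∃ B : Matrix ι ι ℝ, NormedSpace.exp A = B * Bᵀ := by
  refine ⟨NormedSpace.exp ((1 / 2 : ℝ) • A), ?_⟩
  have h : ((1 / 2 : ℝ) • A)ᵀ = (1 / 2 : ℝ) • A := by
    rw [transpose_smul, ← conjTranspose_eq_transpose_of_trivial, hA.eq]
  rw [← exp_transpose, h, ← exp_add_of_commute _ _ (Commute.refl _), ← add_smul]
  norm_num

omit [DecidableEq ι] in
theorem dotProduct_mul_transpose_mulVec (B : Matrix ι ι ℝ) (v : ι → ℝ) :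
    v ⬝ᵥ (B * Bᵀ) *ᵥ v = ∑ i, (v ⬝ᵥ Bᵀ i) ^ 2 := by
  rw [← mulVec_mulVec, dotProduct_mulVec, ← mulVec_transpose]
  simp only [dotProduct, mulVec]
  refine Finset.sum_congr rfl fun i _ => ?_
  rw [sq]
  simp only [mul_comm]

/-- By convexity the slope `(exp x - 1) / x` of the chord from `0` increases, so a squared length
may be replaced by an upper bound for it. -/
theorem _root_.Real.exp_sub_one_mul_le {x y : ℝ} (hx : 0 ≤ x) (hxy : x ≤ y) :
    (Real.exp x - 1) * y ≤ x * (Real.exp y - 1) := by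
  rcases hx.eq_or_lt with rfl | hx'
  · simp
  have hy : 0 < y := hx'.trans_le hxy
  have h := convexOn_exp.2 (Set.mem_univ y) (Set.mem_univ 0) (div_nonneg hx hy.le)
    (sub_nonneg.2 ((div_le_one hy).2 hxy)) (by ring)
  simp only [smul_eq_mul, mul_zero, add_zero, Real.exp_zero, mul_one] at h
  rw [div_mul_cancel₀ _ hy.ne'] at h
  have h2 := mul_le_mul_of_nonneg_right h hy.le
  have h3 : (x / y * Real.exp y + (1 - x / y)) * y = x * Real.exp y + y - x := by
    field_simp
    ring
  linarith

theorem PosSemidef.trace_exp_add_vecMulVec_le' {A : Matrix ι ι ℝ} (hA : A.PosSemidef)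
    (v : ι → ℝ) {R : ℝ} (hR : 0 < R) (hv : v ⬝ᵥ v ≤ R) :
    (NormedSpace.exp (A + vecMulVec v v)).trace
      ≤ (NormedSpace.exp A).trace + (Real.exp R - 1) / R * (v ⬝ᵥ NormedSpace.exp A *ᵥ v) := by
  have hb : 0 ≤ v ⬝ᵥ v := by simpa using dotProduct_star_self_nonneg v
  have hQ : 0 ≤ v ⬝ᵥ NormedSpace.exp A *ᵥ v := by
    obtain ⟨B, hB⟩ := hA.1.exp_eq_mul_transpose
    rw [hB, dotProduct_mul_transpose_mulVec]
    exact Finset.sum_nonneg fun _ _ => sq_nonneg _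
  rcases hb.eq_or_lt with h0 | hpos
  · have hv0 : v = 0 := dotProduct_self_eq_zero.1 h0.symm
    subst hv0
    simp
  have h1 := hA.trace_exp_add_vecMulVec_le v
  have h2 : Real.exp (v ⬝ᵥ v) - 1 ≤ (v ⬝ᵥ v) * ((Real.exp R - 1) / R) := by
    rw [← mul_div_assoc, le_div_iff₀ hR]
    exact Real.exp_sub_one_mul_le hb hv
  have h3 := h1.trans (mul_le_mul_of_nonneg_right h2 hQ)
  rw [mul_assoc] at h3
  linarith [le_of_mul_le_mul_left h3 hpos]

variable {α : Type*} [Fintype α]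

/-- With `exp A = B Bᵀ`, the average of `qᵀ exp(A) q` is a sum over the columns `b` of `B` of
averages of `(q ⬝ b)²`, hence at most `c ∑ |b|² = c tr exp A`. The weights need not sum to `1`,
which allows truncated laws. -/
theorem PosSemidef.sum_trace_exp_add_vecMulVec_le {A : Matrix ι ι ℝ} (hA : A.PosSemidef)
    {w : α → ℝ} (hw : ∀ a, 0 ≤ w a) {q : α → ι → ℝ} {R : ℝ} (hR : 0 < R)
    (hq : ∀ a, w a ≠ 0 → q a ⬝ᵥ q a ≤ R) {c : ℝ}
    (hc : ∀ v, ∑ a, w a * (q a ⬝ᵥ v) ^ 2 ≤ c * (v ⬝ᵥ v)) :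
    ∑ a, w a * (NormedSpace.exp (A + vecMulVec (q a) (q a))).trace
      ≤ (∑ a, w a + c * ((Real.exp R - 1) / R)) * (NormedSpace.exp A).trace := by
  have hK : 0 ≤ (Real.exp R - 1) / R :=
    div_nonneg (sub_nonneg.2 (Real.one_le_exp hR.le)) hR.le
  obtain ⟨B, hB⟩ := hA.1.exp_eq_mul_transpose
  have h1 : ∑ a, w a * (q a ⬝ᵥ NormedSpace.exp A *ᵥ q a) ≤ c * (NormedSpace.exp A).trace := by
    have h2 : (B * Bᵀ).trace = ∑ i, Bᵀ i ⬝ᵥ Bᵀ i := by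
      rw [trace_mul_comm]
      rfl
    simp only [hB, dotProduct_mul_transpose_mulVec, h2, Finset.mul_sum]
    rw [Finset.sum_comm]
    exact Finset.sum_le_sum fun i _ => hc _
  calc ∑ a, w a * (NormedSpace.exp (A + vecMulVec (q a) (q a))).trace
      ≤ ∑ a, (w a * (NormedSpace.exp A).trace
        + (Real.exp R - 1) / R * (w a * (q a ⬝ᵥ NormedSpace.exp A *ᵥ q a))) := by
        refine Finset.sum_le_sum fun a _ => ?_
        by_cases ha : w a = 0
        · simp [ha]
        · have := mul_le_mul_of_nonneg_left
            (hA.trace_exp_add_vecMulVec_le' (q a) hR (hq a ha)) (hw a)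
          linarith
    _ = (∑ a, w a) * (NormedSpace.exp A).trace
        + (Real.exp R - 1) / R * ∑ a, w a * (q a ⬝ᵥ NormedSpace.exp A *ᵥ q a) := by
        rw [Finset.sum_add_distrib, ← Finset.sum_mul, ← Finset.mul_sum]
    _ ≤ _ := by
        have := mul_le_mul_of_nonneg_left h1 hK
        linarith

/-- The base point `A` is arbitrary because fixing the first column `q a` shifts it to `A + q a (q
a)ᵀ` in the induction. -/
theorem PosSemidef.sum_prod_trace_exp_le {w : α → ℝ} (hw : ∀ a, 0 ≤ w a) {q : α → ι → ℝ}
    {R : ℝ} (hR : 0 < R) (hq : ∀ a, w a ≠ 0 → q a ⬝ᵥ q a ≤ R) {c : ℝ} (hc0 : 0 ≤ c)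
    (hc : ∀ v, ∑ a, w a * (q a ⬝ᵥ v) ^ 2 ≤ c * (v ⬝ᵥ v)) (N : ℕ)
    {A : Matrix ι ι ℝ} (hA : A.PosSemidef) :
    ∑ f : Fin N → α, (∏ j, w (f j))
        * (NormedSpace.exp (A + ∑ j, vecMulVec (q (f j)) (q (f j)))).trace
      ≤ (∑ a, w a + c * ((Real.exp R - 1) / R)) ^ N * (NormedSpace.exp A).trace := by
  induction N generalizing A with
  | zero => simp
  | succ N ih =>
    rw [← (Fin.consEquiv fun _ => α).sum_comp, Fintype.sum_prod_type]
    have hg : 0 ≤ (∑ a, w a + c * ((Real.exp R - 1) / R)) ^ N :=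
      pow_nonneg (add_nonneg (Finset.sum_nonneg fun a _ => hw a) (mul_nonneg hc0
        (div_nonneg (sub_nonneg.2 (Real.one_le_exp hR.le)) hR.le))) _
    calc _ = ∑ a, w a * ∑ f : Fin N → α, (∏ j, w (f j)) * (NormedSpace.exp
            ((A + vecMulVec (q a) (q a)) + ∑ j, vecMulVec (q (f j)) (q (f j)))).trace := by
          refine Finset.sum_congr rfl fun a _ => ?_
          rw [Finset.mul_sum]
          refine Finset.sum_congr rfl fun f _ => ?_
          simp [Fin.consEquiv, Fin.prod_univ_succ, Fin.sum_univ_succ, add_assoc, mul_assoc]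
      _ ≤ ∑ a, w a * ((∑ a, w a + c * ((Real.exp R - 1) / R)) ^ N
            * (NormedSpace.exp (A + vecMulVec (q a) (q a))).trace) :=
          Finset.sum_le_sum fun a _ => mul_le_mul_of_nonneg_left
            (ih (hA.add (by simpa using posSemidef_vecMulVec_self_star (q a)))) (hw a)
      _ = (∑ a, w a + c * ((Real.exp R - 1) / R)) ^ N
            * ∑ a, w a * (NormedSpace.exp (A + vecMulVec (q a) (q a))).trace := by
          rw [Finset.mul_sum]
          exact Finset.sum_congr rfl fun a _ => by ring
      _ ≤ _ := by
          rw [pow_succ, mul_assoc]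
          exact mul_le_mul_of_nonneg_left
            (hA.sum_trace_exp_add_vecMulVec_le hw hR hq hc) hg

theorem IsHermitian.trace_exp {A : Matrix ι ι ℝ} (hA : A.IsHermitian) :
    (NormedSpace.exp A).trace = ∑ i, Real.exp (hA.eigenvalues i) := by
  have htr : ∀ m : ℕ, (A ^ m).trace = ∑ i, hA.eigenvalues i ^ m := by
    intro m
    conv_lhs => rw [hA.spectral_theorem]
    rw [← map_pow, diagonal_pow, Unitary.conjStarAlgAut_apply, trace_mul_comm, ← mul_assoc,
      Unitary.coe_star_mul_self, one_mul, trace_diagonal]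
    rfl
  refine (hasSum_trace_exp A).unique ?_
  simp only [htr, Finset.mul_sum]
  refine hasSum_sum fun i _ => ?_
  have := NormedSpace.exp_series_hasSum_exp' (𝕂 := ℝ) (hA.eigenvalues i)
  rwa [← Real.exp_eq_exp_ℝ] at this

theorem IsHermitian.dotProduct_mulVec_eq_sum {A : Matrix ι ι ℝ} (hA : A.IsHermitian)
    (v : ι → ℝ) : ∃ y : ι → ℝ, v ⬝ᵥ v = ∑ i, y i ^ 2 ∧
      v ⬝ᵥ A *ᵥ v = ∑ i, hA.eigenvalues i * y i ^ 2 := by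
  refine ⟨((star hA.eigenvectorUnitary : unitaryGroup ι ℝ) : Matrix ι ι ℝ) *ᵥ v, ?_, ?_⟩
  · have := dotProduct_conjStarAlgAut_diagonal_mulVec hA.eigenvectorUnitary (fun _ => 1) v
    simpa using this
  · conv_lhs => rw [hA.spectral_theorem]
    exact dotProduct_conjStarAlgAut_diagonal_mulVec hA.eigenvectorUnitary _ v

theorem IsHermitian.dotProduct_mulVec_le_of_trace_exp_le {A : Matrix ι ι ℝ} (hA : A.IsHermitian)
    {L : ℝ} (hL : (NormedSpace.exp A).trace ≤ Real.exp L) (v : ι → ℝ) :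
    v ⬝ᵥ A *ᵥ v ≤ L * (v ⬝ᵥ v) := by
  obtain ⟨y, h1, h2⟩ := hA.dotProduct_mulVec_eq_sum v
  rw [h1, h2, Finset.mul_sum]
  refine Finset.sum_le_sum fun i _ => mul_le_mul_of_nonneg_right ?_ (sq_nonneg _)
  rw [← Real.exp_le_exp]
  rw [hA.trace_exp] at hL
  exact (Finset.single_le_sum (f := fun i => Real.exp (hA.eigenvalues i))
    (fun j _ => (Real.exp_pos _).le) (Finset.mem_univ i)).trans hL

theorem l2_opNorm_le_of_dotProduct_le {κ : Type*} [Fintype κ] [DecidableEq κ]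
    (M : Matrix ι κ ℝ) {L : ℝ}
    (h : ∀ v, v ⬝ᵥ (M * Mᵀ) *ᵥ v ≤ L * (v ⬝ᵥ v)) : ‖M‖ ≤ √L := by
  rw [← l2_opNorm_conjTranspose, l2_opNorm_def]
  refine ContinuousLinearMap.opNorm_le_bound _ (Real.sqrt_nonneg _) fun x => ?_
  have e1 : ‖x‖ = √(x.ofLp ⬝ᵥ x.ofLp) := by
    rw [EuclideanSpace.norm_eq]
    simp [dotProduct, sq]
  have e2 : ‖(toEuclideanLin.trans LinearMap.toContinuousLinearMap Mᴴ) x‖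
      = √(x.ofLp ⬝ᵥ (M * Mᵀ) *ᵥ x.ofLp) := by
    rw [EuclideanSpace.norm_eq, ← mulVec_mulVec, dotProduct_mulVec, ← mulVec_transpose]
    simp [dotProduct, sq, conjTranspose_eq_transpose_of_trivial]
  rw [e1, e2, ← Real.sqrt_mul']
  · exact Real.sqrt_le_sqrt (h _)
  · simpa using dotProduct_star_self_nonneg x.ofLp

theorem l2_opNorm_lt_of_trace_exp_lt {κ : Type*} [Fintype κ] [DecidableEq κ] [Nonempty ι]
    (M : Matrix ι κ ℝ) {θ δ : ℝ} (hθ : 0 < θ) (hδ : 0 < δ)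
    (h : (NormedSpace.exp (θ • (M * Mᵀ))).trace < Real.exp (θ * δ ^ 2)) : ‖M‖ < δ := by
  have hS : (θ • (M * Mᵀ)).IsHermitian := by
    simp [IsHermitian, conjTranspose_eq_transpose_of_trivial]
  have hpos : 0 < (NormedSpace.exp (θ • (M * Mᵀ))).trace := by
    rw [hS.trace_exp]
    exact Finset.sum_pos (fun _ _ => Real.exp_pos _) Finset.univ_nonempty
  set T := (NormedSpace.exp (θ • (M * Mᵀ))).trace with hT
  have hL : Real.log T / θ < δ ^ 2 := by
    rw [div_lt_iff₀ hθ, mul_comm, Real.log_lt_iff_lt_exp hpos]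
    exact h
  refine (l2_opNorm_le_of_dotProduct_le M (L := Real.log T / θ) fun v => ?_).trans_lt ?_
  · have := hS.dotProduct_mulVec_le_of_trace_exp_le (L := Real.log T)
      (by rw [Real.exp_log hpos]) v
    rw [smul_mulVec, dotProduct_smul, smul_eq_mul] at this
    rw [div_mul_eq_mul_div, le_div_iff₀ hθ]
    linarith
  · rwa [Real.sqrt_lt' hδ]

/-- Put `x = t / (3μ + t) ≤ 1`. Taylor's bound gives `exp x - 1 ≤ x + 13/18 x²`, where `13/18 = 1/2
+ 2/9`. As `μ x ≤ t / 3`, the left side is at most `-(41/54) x t`, and `41/54 > 3/4`. -/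
theorem _root_.Real.exp_tail_exponent_le {μ t : ℝ} (hμ : 0 ≤ μ) (ht : 0 < t) :
    μ * (Real.exp (t / (3 * μ + t)) - 1) - t / (3 * μ + t) * (μ + t)
      ≤ -(3 / 4 * (t ^ 2 / (3 * μ + t))) := by
  have hD : 0 < 3 * μ + t := by positivity
  have hx0 : 0 ≤ t / (3 * μ + t) := by positivity
  have hx1 : t / (3 * μ + t) ≤ 1 := (div_le_one hD).2 (by linarith)
  have h := Real.exp_bound' hx0 hx1 (n := 3) (by norm_num)
  norm_num [Finset.sum_range_succ, Nat.factorial] at h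
  set x := t / (3 * μ + t) with hx
  have hxt : t ^ 2 / (3 * μ + t) = x * t := by rw [hx]; ring
  have hxD : x * (3 * μ + t) = t := div_mul_cancel₀ _ hD.ne'
  have h2 : Real.exp x - 1 ≤ x + 13 / 18 * x ^ 2 := by
    have : x ^ 3 ≤ x ^ 2 := pow_le_pow_of_le_one hx0 hx1 (by norm_num)
    linarith
  have h3 := mul_le_mul_of_nonneg_left h2 hμ
  have h4 : μ * x ≤ t / 3 := by nlinarith
  have h5 := mul_le_mul_of_nonneg_left h4 hx0
  rw [hxt]
  nlinarith [mul_nonneg hx0 ht.le]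

/-- A matrix Chernoff bound for a matrix with independent identically distributed columns. -/
theorem sum_prod_ite_le_l2_opNorm_le [Nonempty ι] {w : α → ℝ} (hw : ∀ a, 0 ≤ w a)
    {q : α → ι → ℝ} {R : ℝ} (hR : 0 < R) (hq : ∀ a, w a ≠ 0 → q a ⬝ᵥ q a ≤ R)
    {ω : ℝ} (hω : 0 ≤ ω)
    (hc : ∀ v, ∑ a, w a * (q a ⬝ᵥ v) ^ 2 ≤ ω * (∑ a, w a) * (v ⬝ᵥ v)) (N : ℕ)
    {δ : ℝ} (hδ : 0 < δ) (ht : N * ω < δ ^ 2) :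
    ∑ f : Fin N → α, (if δ ≤ ‖(of fun i j => q (f j) i : Matrix ι (Fin N) ℝ)‖
        then ∏ j, w (f j) else 0)
      ≤ (∑ a, w a) ^ N * (Fintype.card ι * Real.exp
        (-(3 * (δ ^ 2 - N * ω) ^ 2 / (4 * R * (δ ^ 2 + 2 * (N * ω)))))) := by
  set Z := ∑ a, w a with hZ
  have hZ0 : 0 ≤ Z := Finset.sum_nonneg fun a _ => hw a
  set μ : ℝ := N * ω with hμ
  have hμ0 : 0 ≤ μ := by positivity
  set t := δ ^ 2 - μ with ht'
  have ht0 : 0 < t := sub_pos.2 ht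
  -- The Chernoff parameter is `θ = x / R`, so the scaled columns `√θ q` have squared length at most
  -- `x`; note `3μ + t = δ² + 2μ`.
  set x := t / (3 * μ + t) with hx
  have hx0 : 0 < x := by positivity
  set θ := x / R with hθ
  have hθ0 : 0 < θ := by positivity
  have hsq : √θ * √θ = θ := Real.mul_self_sqrt hθ0.le
  have h1 := PosSemidef.sum_prod_trace_exp_le hw (q := fun a => √θ • q a) hx0
    (fun a ha => by
      have : θ * R = x := div_mul_cancel₀ _ hR.ne'
      rw [smul_dotProduct, dotProduct_smul, smul_smul, hsq, smul_eq_mul, ← this]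
      exact mul_le_mul_of_nonneg_left (hq a ha) hθ0.le)
    (c := θ * (ω * Z)) (by positivity)
    (fun v => by
      have : ∑ a, w a * ((√θ • q a) ⬝ᵥ v) ^ 2 = θ * ∑ a, w a * (q a ⬝ᵥ v) ^ 2 := by
        rw [Finset.mul_sum]
        refine Finset.sum_congr rfl fun a _ => ?_
        rw [smul_dotProduct, smul_eq_mul, mul_pow, sq (√θ), hsq]
        ring
      rw [this, mul_assoc θ]
      exact mul_le_mul_of_nonneg_left (hc v) hθ0.le)
    N PosSemidef.zero
  have hM : ∀ f : Fin N → α, ∑ j, vecMulVec (√θ • q (f j)) (√θ • q (f j))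
      = θ • ((of fun i j => q (f j) i : Matrix ι (Fin N) ℝ) * (of fun i j => q (f j) i)ᵀ) := by
    intro f
    ext i i'
    simp only [sum_apply, vecMulVec_apply, Pi.smul_apply, smul_eq_mul, smul_apply, mul_apply,
      transpose_apply, of_apply, Finset.mul_sum]
    refine Finset.sum_congr rfl fun j _ => ?_
    rw [mul_mul_mul_comm, hsq]
  simp only [hM, zero_add, NormedSpace.exp_zero, trace_one] at h1
  -- Markov's inequality: the trace of `exp (θ M Mᵀ)` is nonnegative, and at least `exp (θ δ²)`
  -- wherever `δ ≤ ‖M‖`.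
  have h2 : (∑ f : Fin N → α, (if δ ≤ ‖(of fun i j => q (f j) i : Matrix ι (Fin N) ℝ)‖
        then ∏ j, w (f j) else 0)) * Real.exp (θ * δ ^ 2)
      ≤ (Z + θ * (ω * Z) * ((Real.exp x - 1) / x)) ^ N * Fintype.card ι := by
    refine le_trans ?_ h1
    rw [Finset.sum_mul]
    refine Finset.sum_le_sum fun f _ => ?_
    have hP : 0 ≤ ∏ j, w (f j) := Finset.prod_nonneg fun j _ => hw _
    split_ifs with h
    · refine mul_le_mul_of_nonneg_left ?_ hP
      by_contra hlt
      exact absurd (l2_opNorm_lt_of_trace_exp_lt _ hθ0 hδ (not_le.1 hlt)) (not_lt.2 h)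
    · rw [zero_mul]
      refine mul_nonneg hP ?_
      rw [IsHermitian.trace_exp (by
        simp [IsHermitian, conjTranspose_eq_transpose_of_trivial])]
      exact Finset.sum_nonneg fun _ _ => (Real.exp_pos _).le
  have h3 : Z + θ * (ω * Z) * ((Real.exp x - 1) / x)
      = Z * (1 + ω * ((Real.exp x - 1) / R)) := by
    rw [hθ]
    field_simp
  have h4 : (1 + ω * ((Real.exp x - 1) / R)) ^ N ≤ Real.exp (μ * (Real.exp x - 1) / R) := by
    have h5 : 0 ≤ ω * ((Real.exp x - 1) / R) :=
      mul_nonneg hω (div_nonneg (sub_nonneg.2 (Real.one_le_exp hx0.le)) hR.le)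
    calc _ ≤ Real.exp (ω * ((Real.exp x - 1) / R)) ^ N :=
          pow_le_pow_left₀ (by positivity)
            ((add_comm _ _).trans_le (Real.add_one_le_exp _)) _
      _ = _ := by
          rw [← Real.exp_nat_mul, hμ]
          congr 1
          ring
  have h6 : μ * (Real.exp x - 1) / R - θ * δ ^ 2
      ≤ -(3 * t ^ 2 / (4 * R * (δ ^ 2 + 2 * μ))) := by
    have h7 := div_le_div_of_nonneg_right (Real.exp_tail_exponent_le hμ0 ht0) hR.le
    have e1 : δ ^ 2 = μ + t := by rw [ht']; ring
    have e2 : μ + t + 2 * μ = 3 * μ + t := by ring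
    rw [e1, e2, hθ]
    calc _ = _ := by rw [hx]; ring
      _ ≤ _ := h7
      _ = _ := by field_simp
  rw [h3, mul_pow] at h2
  rw [← mul_le_mul_iff_left₀ (Real.exp_pos (θ * δ ^ 2))]
  refine h2.trans ?_
  rw [mul_assoc, mul_assoc]
  refine mul_le_mul_of_nonneg_left ?_ (pow_nonneg hZ0 _)
  rw [mul_comm, mul_assoc, ← Real.exp_add]
  refine mul_le_mul_of_nonneg_left (h4.trans (Real.exp_le_exp.2 ?_)) (Nat.cast_nonneg _)
  linarith

end Matrix

/-! ### Size of a random subset. -/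

namespace PlantedSubgraph

open scoped Matrix

variable {k : ℕ}

/-- The generating function of `|Ω|`; at `y = exp s` it is the moment generating function. -/
theorem sum_subsetWeight_mul_pow (p y : ℝ) :
    ∑ Ω : Finset (Fin k), subsetWeight p Ω * y ^ Ω.card = (p * y + (1 - p)) ^ k := by
  rw [← Fin.sum_pow_mul_eq_add_pow]
  refine Finset.sum_congr rfl fun Ω _ => ?_
  rw [subsetWeight, mul_pow]
  ring

theorem subsetWeight_nonneg {p : ℝ} (hp0 : 0 ≤ p) (hp1 : p ≤ 1) (Ω : Finset (Fin k)) :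
    0 ≤ subsetWeight p Ω :=
  mul_nonneg (pow_nonneg hp0 _) (pow_nonneg (sub_nonneg.2 hp1) _)

/-- Chernoff's bound for the size of a random subset. -/
theorem one_sub_exp_le_sum_subsetWeight {p : ℝ} (hp0 : 0 ≤ p) (hp1 : p ≤ 1) {l : ℕ}
    (hl : (k : ℝ) * p < l) :
    1 - Real.exp (-(((l : ℝ) - k * p) ^ 2 / (l + k * p)))
      ≤ ∑ Ω : Finset (Fin k) with Ω.card ≤ l, subsetWeight p Ω := by
  have ha0 : 0 ≤ (k : ℝ) * p := by positivity
  set a := (k : ℝ) * p with ha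
  have hl0 : 0 < (l : ℝ) := ha0.trans_lt hl
  obtain ⟨s, hs0, hs⟩ : ∃ s : ℝ, 0 ≤ s ∧
      a * (Real.exp s - 1) - l * s ≤ -((l - a) ^ 2 / (l + a)) := by
    rcases ha0.eq_or_lt with h0 | hpos
    -- For `k p = 0` the optimal `s` is infinite; `s = 1` already gives the required exponent `-l`.
    · refine ⟨1, zero_le_one, ?_⟩
      rw [← h0]
      field_simp
      simp [sq]
    · have hx : 0 ≤ (l - a) / a := div_nonneg (by linarith) hpos.le
      -- The optimal choice `s = log (l / a)`; the quotient form of the exponent comes from `log (1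
      -- + u) ≥ 2u / (u + 2)`.
      refine ⟨Real.log (1 + (l - a) / a), Real.log_nonneg (by linarith), ?_⟩
      have h := mul_le_mul_of_nonneg_left (Real.le_log_one_add_of_nonneg hx) hl0.le
      rw [Real.exp_log (by linarith)]
      have e : (l : ℝ) * (2 * ((l - a) / a) / ((l - a) / a + 2))
          = (l - a) + (l - a) ^ 2 / (l + a) := by
        have : (l - a) / a + 2 = (l + a) / a := by
          field_simp
          ring
        rw [this]
        field_simp
        ring
      rw [e] at h
      have e2 : a * (1 + (l - a) / a - 1) = l - a := by
        field_simp
        ring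
      rw [e2]
      linarith
  have htot : ∑ Ω : Finset (Fin k), subsetWeight p Ω = 1 := by
    simpa using sum_subsetWeight_mul_pow (k := k) p 1
  rw [← Finset.sum_filter_add_sum_filter_not _ (fun Ω : Finset (Fin k) => Ω.card ≤ l)] at htot
  suffices h : ∑ Ω : Finset (Fin k) with ¬ Ω.card ≤ l, subsetWeight p Ω
      ≤ Real.exp (-((l - a) ^ 2 / (l + a))) by linarith
  refine le_trans ?_ (Real.exp_le_exp.2 hs)
  have h1 : (∑ Ω : Finset (Fin k) with ¬ Ω.card ≤ l, subsetWeight p Ω) * Real.exp (l * s)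
      ≤ Real.exp (a * (Real.exp s - 1)) := by
    calc _ ≤ ∑ Ω : Finset (Fin k) with ¬ Ω.card ≤ l, subsetWeight p Ω * Real.exp s ^ Ω.card := by
          rw [Finset.sum_mul]
          refine Finset.sum_le_sum fun Ω hΩ => ?_
          refine mul_le_mul_of_nonneg_left ?_ (subsetWeight_nonneg hp0 hp1 Ω)
          rw [← Real.exp_nat_mul, Real.exp_le_exp]
          have := (Finset.mem_filter.1 hΩ).2
          exact mul_le_mul_of_nonneg_right (by exact_mod_cast (not_le.1 this).le) hs0
      _ ≤ ∑ Ω : Finset (Fin k), subsetWeight p Ω * Real.exp s ^ Ω.card :=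
          Finset.sum_le_sum_of_subset_of_nonneg (Finset.filter_subset _ _) fun Ω _ _ =>
            mul_nonneg (subsetWeight_nonneg hp0 hp1 Ω) (by positivity)
      _ = (p * (Real.exp s - 1) + 1) ^ k := by
          rw [sum_subsetWeight_mul_pow]
          congr 1
          ring
      _ ≤ Real.exp (p * (Real.exp s - 1)) ^ k :=
          pow_le_pow_left₀ (add_nonneg (mul_nonneg hp0 (sub_nonneg.2 (Real.one_le_exp hs0)))
            zero_le_one) (Real.add_one_le_exp _) _
      _ = _ := by rw [← Real.exp_nat_mul, ha, mul_assoc]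
  rw [Real.exp_sub, le_div_iff₀ (Real.exp_pos _)]
  exact h1

/-! ### Completions: existence, length and second moment. -/

variable (S : Submodule ℝ (EuclideanSpace ℝ (Fin k)))

theorem projMatrix_mulVec (v : Fin k → ℝ) :
    projMatrix S *ᵥ v = S.starProjection (WithLp.toLp 2 v) := by
  have h : WithLp.toLp 2 v = ∑ j, v j • EuclideanSpace.single j (1 : ℝ) := by
    ext i
    simp [Finset.sum_apply, Pi.single_apply]
  rw [h, map_sum]
  funext i
  simp [Matrix.mulVec, dotProduct, projMatrix, mul_comm]

theorem projMatrix_isHermitian : (projMatrix S).IsHermitian := by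
  ext i j
  have h := S.inner_starProjection_left_eq_right (EuclideanSpace.single i (1 : ℝ))
    (EuclideanSpace.single j 1)
  simpa [projMatrix, EuclideanSpace.inner_single_left, EuclideanSpace.inner_single_right] using h

theorem lambdaMin_le_eigenvalues {ι : Type*} [Fintype ι] [DecidableEq ι] {A : Matrix ι ι ℝ}
    (hA : A.IsHermitian) (i : ι) : lambdaMin A ≤ hA.eigenvalues i :=
  csInf_le (Matrix.finite_real_spectrum).bddBelow (hA.eigenvalues_mem_spectrum_real i)

theorem lambdaMin_mul_le {ι : Type*} [Fintype ι] [DecidableEq ι] {A : Matrix ι ι ℝ}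
    (hA : A.IsHermitian) (v : ι → ℝ) : lambdaMin A * (v ⬝ᵥ v) ≤ v ⬝ᵥ A *ᵥ v := by
  obtain ⟨y, h1, h2⟩ := hA.dotProduct_mulVec_eq_sum v
  rw [h1, h2, Finset.mul_sum]
  exact Finset.sum_le_sum fun i _ =>
    mul_le_mul_of_nonneg_right (lambdaMin_le_eigenvalues hA i) (sq_nonneg _)

theorem zeta_le {l : ℕ} {Ω : Finset (Fin k)} (h0 : Ω.Nonempty) (hl : Ω.card ≤ l) :
    zeta S l ≤ lambdaMin
      ((projMatrix S).submatrix (fun i : Ω => (i : Fin k)) (fun j : Ω => (j : Fin k))) := by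
  refine csInf_le (Set.Finite.bddBelow ?_) ⟨Ω, h0, hl, rfl⟩
  refine (Set.finite_range fun Ω : Finset (Fin k) => lambdaMin ((projMatrix S).submatrix
    (fun i : Ω => (i : Fin k)) (fun j : Ω => (j : Fin k)))).subset ?_
  rintro x ⟨Ω, -, -, rfl⟩
  exact ⟨Ω, rfl⟩

/-- Let `P` be the projection onto `S`. As `P_{Ω,Ω} ≥ ζ > 0`, one can solve `P_{Ω,Ω} y = 1`; extend
`y` by zero to `z` and take `q = P z`. Then `|q|² = zᵀPz = ∑ y_i ≥ ζ |y|²`, and Cauchy–Schwarz `(∑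
y_i)² ≤ |Ω| |y|²` gives `|q|² ≤ |Ω| / ζ`. The minimum-norm completion inherits the bound. -/
theorem exists_completion {l : ℕ} (hζ : 0 < zeta S l) {Ω : Finset (Fin k)} (hl : Ω.card ≤ l) :
    ∃ q ∈ completions S Ω, ‖q‖ ^ 2 ≤ l / zeta S l := by
  rcases Ω.eq_empty_or_nonempty with rfl | h0
  · refine ⟨0, ⟨S.zero_mem, by simp⟩, ?_⟩
    simpa using div_nonneg (Nat.cast_nonneg l) hζ.le
  set A := (projMatrix S).submatrix (fun i : Ω => (i : Fin k)) (fun j : Ω => (j : Fin k)) with hAdef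
  have hA : A.IsHermitian := (projMatrix_isHermitian S).submatrix _
  have hmin : ∀ v, zeta S l * (v ⬝ᵥ v) ≤ v ⬝ᵥ A *ᵥ v := fun v =>
    (mul_le_mul_of_nonneg_right (zeta_le S h0 hl)
      (by simpa using dotProduct_star_self_nonneg v)).trans (lambdaMin_mul_le hA v)
  have hinj : Function.Injective A.mulVec := by
    refine (injective_iff_map_eq_zero (Matrix.mulVecLin A)).2 fun v hv => ?_
    have h1 := hmin v
    rw [show A *ᵥ v = 0 from hv, dotProduct_zero] at h1
    have h2 : 0 ≤ v ⬝ᵥ v := by simpa using dotProduct_star_self_nonneg v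
    exact dotProduct_self_eq_zero.1 (le_antisymm (by nlinarith) h2)
  obtain ⟨y, hy⟩ : ∃ y, A *ᵥ y = fun _ => 1 :=
    (LinearMap.injective_iff_surjective (f := Matrix.mulVecLin A)).1 hinj _
  set z : Fin k → ℝ := fun i => if h : i ∈ Ω then y ⟨i, h⟩ else 0 with hz
  have hsum : ∀ g : Fin k → ℝ, ∑ i, g i * z i = ∑ i : Ω, g i * y i := by
    intro g
    rw [← Finset.sum_subset (Finset.subset_univ Ω) (fun i _ hi => by simp [hz, hi]),
      ← Finset.sum_coe_sort]
    exact Finset.sum_congr rfl fun i _ => by simp [hz]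
  set q := S.starProjection (WithLp.toLp 2 z) with hq
  have hq1 : ∀ i ∈ Ω, q i = 1 := by
    intro i hi
    rw [hq, ← projMatrix_mulVec]
    have := congrFun hy ⟨i, hi⟩
    rw [← this]
    exact hsum _
  refine ⟨q, ⟨S.starProjection_apply_mem _, hq1⟩, ?_⟩
  have hnorm : ‖q‖ ^ 2 = ∑ i : Ω, y i := by
    rw [← real_inner_self_eq_norm_sq, hq, S.inner_starProjection_left_eq_right,
      S.starProjection_eq_self_iff.2 (S.starProjection_apply_mem _), ← hq]
    have h1 : ∑ i : Ω, q i * y i = ∑ i : Ω, y i :=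
      Finset.sum_congr rfl fun i _ => by rw [hq1 i i.2, one_mul]
    rw [← h1, ← hsum q]
    simp [PiLp.inner_apply]
  have hyy := hmin y
  rw [hy] at hyy
  have h1 : y ⬝ᵥ (fun _ => 1) = ∑ i : Ω, y i := by simp [dotProduct]
  rw [h1, ← hnorm] at hyy
  have hcs : (‖q‖ ^ 2) ^ 2 ≤ Ω.card * (y ⬝ᵥ y) := by
    rw [hnorm]
    have := sq_sum_le_card_mul_sum_sq (s := Finset.univ) (f := y)
    simpa [dotProduct, sq] using this
  rw [le_div_iff₀ hζ]
  have hcl : (Ω.card : ℝ) ≤ l := by exact_mod_cast hl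
  have hn : 0 ≤ ‖q‖ ^ 2 := sq_nonneg _
  have hc0 : (0 : ℝ) ≤ Ω.card := Nat.cast_nonneg _
  rcases hn.eq_or_lt with h | h
  · rw [← h, zero_mul]
    exact Nat.cast_nonneg l
  · have h3 : (‖q‖ ^ 2 * zeta S l) * ‖q‖ ^ 2 ≤ Ω.card * ‖q‖ ^ 2 := by
      calc _ = (‖q‖ ^ 2) ^ 2 * zeta S l := by ring
        _ ≤ Ω.card * (y ⬝ᵥ y) * zeta S l := mul_le_mul_of_nonneg_right hcs hζ.le
        _ = Ω.card * (zeta S l * (y ⬝ᵥ y)) := by ring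
        _ ≤ _ := mul_le_mul_of_nonneg_left hyy hc0
    exact (le_of_mul_le_mul_right h3 h).trans hcl

theorem isClosed_completions (Ω : Finset (Fin k)) : IsClosed (completions S Ω) := by
  have : completions S Ω
      = (S : Set (EuclideanSpace ℝ (Fin k))) ∩ ⋂ i ∈ Ω, {q | q i = 1} := by
    ext q
    simp [completions]
  rw [this]
  refine S.closed_of_finiteDimensional.inter (isClosed_biInter fun i _ => ?_)
  exact isClosed_eq (EuclideanSpace.proj i).continuous continuous_const

theorem minNormCompletion_spec {Ω : Finset (Fin k)} (h : (completions S Ω).Nonempty) :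
    minNormCompletion S Ω ∈ completions S Ω ∧
      ∀ q ∈ completions S Ω, ‖minNormCompletion S Ω‖ ≤ ‖q‖ := by
  have hex : ∃ q ∈ completions S Ω, ∀ q' ∈ completions S Ω, ‖q‖ ≤ ‖q'‖ := by
    obtain ⟨q, hq, hd⟩ := (isClosed_completions S Ω).exists_infDist_eq_dist h 0
    refine ⟨q, hq, fun q' hq' => ?_⟩
    have := Metric.infDist_le_dist_of_mem (x := 0) hq'
    rw [hd] at this
    simpa using this
  rw [minNormCompletion, dif_pos hex]
  exact hex.choose_spec

/-- The second moment hypothesis of the matrix Chernoff bound: a quadratic form is at most the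
spectral norm times `|v|²`, and multiplying by the mass of the small sets undoes the conditioning.
-/
theorem sum_subsetWeight_mul_sq_le {p : ℝ} {l : ℕ}
    (hZ : 0 < ∑ Ω : Finset (Fin k) with Ω.card ≤ l, subsetWeight p Ω) (v : Fin k → ℝ) :
    ∑ Ω : Finset (Fin k) with Ω.card ≤ l,
        subsetWeight p Ω * ((minNormCompletion S Ω).ofLp ⬝ᵥ v) ^ 2
      ≤ combWidth S l p * (∑ Ω : Finset (Fin k) with Ω.card ≤ l, subsetWeight p Ω)
        * (v ⬝ᵥ v) := by
  set Z := ∑ Ω : Finset (Fin k) with Ω.card ≤ l, subsetWeight p Ω with hZdef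
  have h1 : v ⬝ᵥ condCorrelation S l p *ᵥ v = Z⁻¹ * ∑ Ω : Finset (Fin k) with Ω.card ≤ l,
        subsetWeight p Ω * ((minNormCompletion S Ω).ofLp ⬝ᵥ v) ^ 2 := by
    rw [condCorrelation, Matrix.smul_mulVec, dotProduct_smul, smul_eq_mul, Matrix.sum_mulVec,
      dotProduct_sum]
    congr 1
    refine Finset.sum_congr rfl fun Ω _ => ?_
    rw [Matrix.smul_mulVec, dotProduct_smul, smul_eq_mul, Matrix.vecMulVec_mulVec]
    rw [op_smul_eq_smul, dotProduct_smul, smul_eq_mul, dotProduct_comm v, sq]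
  have h2 : v ⬝ᵥ condCorrelation S l p *ᵥ v ≤ combWidth S l p * (v ⬝ᵥ v) := by
    have e : v ⬝ᵥ v = ‖WithLp.toLp 2 v‖ ^ 2 := by
      rw [EuclideanSpace.real_norm_sq_eq]
      simp [dotProduct, sq]
    have h3 := real_inner_le_norm (WithLp.toLp 2 v)
      (WithLp.toLp 2 (condCorrelation S l p *ᵥ v))
    have h4 := Matrix.l2_opNorm_mulVec (condCorrelation S l p) (WithLp.toLp 2 v)
    have h5 : inner ℝ (WithLp.toLp 2 v) (WithLp.toLp 2 (condCorrelation S l p *ᵥ v))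
        = v ⬝ᵥ condCorrelation S l p *ᵥ v := by
      simp [PiLp.inner_apply, dotProduct, mul_comm]
    rw [← h5, e, combWidth]
    refine h3.trans ((mul_le_mul_of_nonneg_left h4 (norm_nonneg _)).trans_eq ?_)
    ring
  rw [h1, inv_mul_le_iff₀ hZ] at h2
  linarith

end PlantedSubgraph

/-! ### Neighborhoods in the random graph. -/

namespace PlantedSubgraph

open scoped Matrix

variable {k n : ℕ} {h : k < n} {Γ : SimpleGraph (Fin k)} {p : ℝ}
  {X : Type*} [MeasurableSpace X] {μ : Measure X} {𝔊 : X → SimpleGraph (Fin n)}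

open Classical in
/-- The set of core nodes adjacent to the `j`-th outer node. -/
noncomputable def neighborSet (h : k < n) (G : SimpleGraph (Fin n)) (j : Fin (n - k)) :
    Finset (Fin k) :=
  Finset.univ.filter fun i => G.Adj (coreNode h i) (outerNode h j)

theorem coreNode_lt_outerNode (h : k < n) (i : Fin k) (j : Fin (n - k)) : coreNode h i < outerNode h j := by
  simp only [coreNode, outerNode, Fin.lt_def, Fin.val_castLE]
  omega

theorem IsPlantedErdosRenyi.prob_le_one [IsProbabilityMeasure μ]
    (hG : IsPlantedErdosRenyi h Γ p μ 𝔊) (i : Fin k) : p ≤ 1 := by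
  have hj : 0 < n - k := Nat.sub_pos_of_lt h
  have h1 := hG.prob_adj (coreNode h i) (outerNode h ⟨0, hj⟩) (coreNode_lt_outerNode h _ _)
    (by simp [outerNode])
  have h2 : ENNReal.ofReal p ≤ 1 := h1 ▸ MeasureTheory.prob_le_one
  simpa using h2

/-- The neighborhoods of the outer nodes are independent random subsets. -/
theorem IsPlantedErdosRenyi.measureReal_neighborSet_eq [IsProbabilityMeasure μ] (hp0 : 0 ≤ p)
    (hG : IsPlantedErdosRenyi h Γ p μ 𝔊) (f : Fin (n - k) → Finset (Fin k)) :
    MeasurableSet {x | ∀ j, neighborSet h (𝔊 x) j = f j} ∧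
    μ.real {x | ∀ j, neighborSet h (𝔊 x) j = f j} = ∏ j, subsetWeight p (f j) := by
  let g : Fin (n - k) × Fin k → {e : Fin n × Fin n // e.1 < e.2 ∧ k ≤ (e.2 : ℕ)} := fun e =>
    ⟨(coreNode h e.2, outerNode h e.1), coreNode_lt_outerNode h _ _, by simp [outerNode]⟩
  have hg : Function.Injective g := by
    rintro ⟨j, i⟩ ⟨j', i'⟩ he
    simpa [g, coreNode, outerNode, Fin.ext_iff, and_comm] using he
  have hind := (iIndepSet_iff_iIndep _ _).1 (hG.indep.precomp hg)
  let s : Fin (n - k) × Fin k → Set X := fun e =>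
    {x | (𝔊 x).Adj (coreNode h e.2) (outerNode h e.1)}
  have hs : ∀ e, MeasurableSet (s e) := fun e => hG.measurableSet_adj _ _
  let s' : Fin (n - k) × Fin k → Set X := fun e => if e.2 ∈ f e.1 then s e else (s e)ᶜ
  have hs' : ∀ e, MeasurableSet (s' e) := fun e => by
    simp only [s']
    split_ifs
    exacts [hs e, (hs e).compl]
  have hset : {x | ∀ j, neighborSet h (𝔊 x) j = f j} = ⋂ e, s' e := by
    ext x
    simp only [Set.mem_ofPred_eq, Set.mem_iInter, Prod.forall, Finset.ext_iff, neighborSet,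
      Finset.mem_filter, Finset.mem_univ, true_and]
    refine forall_congr' fun j => forall_congr' fun i => ?_
    by_cases hi : i ∈ f j <;> simp [s', s, hi]
  have hprob : ∀ e, μ.real (s e) = p := fun e => by
    rw [measureReal_def, hG.prob_adj _ _ (coreNode_lt_outerNode h _ _) (by simp [outerNode]),
      ENNReal.toReal_ofReal hp0]
  rw [hset]
  refine ⟨MeasurableSet.iInter hs', ?_⟩
  rw [measureReal_def, hind.meas_iInter (s := s') fun e => ?_, ENNReal.toReal_prod,
    Fintype.prod_prod_type]
  · refine Finset.prod_congr rfl fun j _ => ?_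
    have : ∀ i, (μ (s' (j, i))).toReal = if i ∈ f j then p else 1 - p := fun i => by
      simp only [s']
      split_ifs
      · exact hprob _
      · rw [← measureReal_def, measureReal_compl (hs _), hprob, probReal_univ]
    simp only [this]
    rw [Finset.prod_ite, Finset.prod_const, Finset.prod_const, subsetWeight,
      Finset.filter_not, Finset.card_sdiff]
    simp
  · have hm : MeasurableSet[MeasurableSpace.generateFrom {s e}] (s e) :=
      MeasurableSpace.measurableSet_generateFrom rfl
    simp only [s']
    split_ifs
    exacts [hm, hm.compl]

/-- The events prescribing all neighborhoods are measurable and pairwise disjoint, and those indexed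
by `F` lie in `s`. Hence `s` itself need not be measurable. -/
theorem IsPlantedErdosRenyi.sum_prod_subsetWeight_le [IsProbabilityMeasure μ] (hp0 : 0 ≤ p)
    (hG : IsPlantedErdosRenyi h Γ p μ 𝔊) (F : Finset (Fin (n - k) → Finset (Fin k)))
    {s : Set X} (hs : ∀ x, (fun j => neighborSet h (𝔊 x) j) ∈ F → x ∈ s) :
    ∑ f ∈ F, ∏ j, subsetWeight p (f j) ≤ μ.real s := by
  rw [← Finset.sum_congr rfl fun f _ => (hG.measureReal_neighborSet_eq hp0 f).2,
    ← measureReal_biUnion_finset]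
  · refine measureReal_mono fun x hx => ?_
    simp only [Set.mem_iUnion, Set.mem_ofPred_eq] at hx
    obtain ⟨f, hf, hx⟩ := hx
    refine hs x ?_
    rwa [show (fun j => neighborSet h (𝔊 x) j) = f from funext hx]
  · intro f _ f' _ hne
    refine Set.disjoint_left.2 fun x hx hx' => hne ?_
    funext j
    exact (hx j).symm.trans (hx' j)
  · exact fun f _ => (hG.measureReal_neighborSet_eq hp0 f).1

/-- The probability that the minimum-norm completions of the neighborhoods of the outer nodes
form a matrix of small spectral norm. -/
theorem le_sum_prod_subsetWeight (S : Submodule ℝ (EuclideanSpace ℝ (Fin k))) (hk : 0 < k)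
    {l : ℕ} (hl : 0 < l) (hp0 : 0 ≤ p) (hp1 : p ≤ 1) (hζ : 0 < zeta S l)
    (hZ : 0 < ∑ Ω : Finset (Fin k) with Ω.card ≤ l, subsetWeight p Ω) (N : ℕ)
    {δ : ℝ} (hδ : 0 < δ) (ht : N * combWidth S l p < δ ^ 2) :
    (1 - k * Real.exp (-(3 * zeta S l * (δ ^ 2 - N * combWidth S l p) ^ 2
        / (4 * l * (δ ^ 2 + 2 * N * combWidth S l p)))))
        * (∑ Ω : Finset (Fin k) with Ω.card ≤ l, subsetWeight p Ω) ^ N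
      ≤ ∑ f : Fin N → Finset (Fin k) with (∀ j, (f j).card ≤ l) ∧
          ‖(Matrix.of fun i j => minNormCompletion S (f j) i : Matrix (Fin k) (Fin N) ℝ)‖ < δ,
        ∏ j, subsetWeight p (f j) := by
  have : Nonempty (Fin k) := ⟨⟨0, hk⟩⟩
  have hl' : (0 : ℝ) < l := by exact_mod_cast hl
  -- The law of `Ω` restricted to small sets and left unnormalized, so that its total mass supplies
  -- the factor `Z ^ N`.
  set w : Finset (Fin k) → ℝ := fun Ω => if Ω.card ≤ l then subsetWeight p Ω else 0 with hw
  have hw0 : ∀ Ω, 0 ≤ w Ω := fun Ω => by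
    simp only [hw]
    split_ifs
    exacts [subsetWeight_nonneg hp0 hp1 Ω, le_rfl]
  have hsumw : ∑ Ω, w Ω = ∑ Ω : Finset (Fin k) with Ω.card ≤ l, subsetWeight p Ω :=
    (Finset.sum_filter _ _).symm
  have hprod : ∀ f : Fin N → Finset (Fin k),
      ∏ j, w (f j) = if ∀ j, (f j).card ≤ l then ∏ j, subsetWeight p (f j) else 0 := by
    intro f
    split_ifs with hf
    · exact Finset.prod_congr rfl fun j _ => if_pos (hf j)
    · obtain ⟨j, hj⟩ := not_forall.1 hf
      exact Finset.prod_eq_zero (Finset.mem_univ j) (if_neg hj)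
  have hq : ∀ Ω, w Ω ≠ 0 →
      (minNormCompletion S Ω).ofLp ⬝ᵥ (minNormCompletion S Ω).ofLp ≤ l / zeta S l := by
    intro Ω hΩ
    have hc : Ω.card ≤ l := by
      by_contra hc
      exact hΩ (if_neg hc)
    obtain ⟨q, hq, hqn⟩ := exists_completion S hζ hc
    have h1 := (minNormCompletion_spec S ⟨q, hq⟩).2 q hq
    have e : (minNormCompletion S Ω).ofLp ⬝ᵥ (minNormCompletion S Ω).ofLp
        = ‖minNormCompletion S Ω‖ ^ 2 := by
      rw [EuclideanSpace.real_norm_sq_eq]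
      simp [dotProduct, sq]
    rw [e]
    exact (pow_le_pow_left₀ (norm_nonneg _) h1 2).trans hqn
  have key := Matrix.sum_prod_ite_le_l2_opNorm_le hw0
    (q := fun Ω => (minNormCompletion S Ω).ofLp) (div_pos hl' hζ) hq
    (ω := combWidth S l p) (norm_nonneg _)
    (fun v => by
      have := sum_subsetWeight_mul_sq_le S hZ v
      rw [hsumw]
      refine le_trans (le_of_eq ?_) this
      rw [Finset.sum_filter]
      exact Finset.sum_congr rfl fun Ω _ => by simp only [hw, ite_mul, zero_mul]) N hδ ht
  have hpow : (∑ Ω, w Ω) ^ N = ∑ f : Fin N → Finset (Fin k), ∏ j, w (f j) := by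
    rw [Finset.sum_pow', Fintype.piFinset_univ]
  have hsplit : ∑ f : Fin N → Finset (Fin k) with (∀ j, (f j).card ≤ l) ∧
          ‖(Matrix.of fun i j => minNormCompletion S (f j) i : Matrix (Fin k) (Fin N) ℝ)‖ < δ,
        ∏ j, subsetWeight p (f j)
      = (∑ Ω, w Ω) ^ N - ∑ f : Fin N → Finset (Fin k),
        (if δ ≤ ‖(Matrix.of fun i j => minNormCompletion S (f j) i : Matrix (Fin k) (Fin N) ℝ)‖
          then ∏ j, w (f j) else 0) := by
    rw [hpow, ← Finset.sum_sub_distrib, Finset.sum_filter]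
    refine Finset.sum_congr rfl fun f _ => ?_
    rw [hprod]
    by_cases h1 : ∀ j, (f j).card ≤ l <;>
    by_cases h2 : δ ≤ ‖(Matrix.of fun i j => minNormCompletion S (f j) i :
      Matrix (Fin k) (Fin N) ℝ)‖ <;>
    simp [h1, h2, not_lt.2, not_le.1]
  rw [hsplit, ← hsumw]
  have e : 3 * (δ ^ 2 - N * combWidth S l p) ^ 2
      / (4 * (l / zeta S l) * (δ ^ 2 + 2 * (N * combWidth S l p)))
      = 3 * zeta S l * (δ ^ 2 - N * combWidth S l p) ^ 2
        / (4 * l * (δ ^ 2 + 2 * N * combWidth S l p)) := by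
    rw [← mul_assoc 2]
    field_simp
  rw [e, Fintype.card_fin] at key
  linarith

end PlantedSubgraph

/-! ### Degenerate cases and conclusion. -/

open PlantedSubgraph in
theorem proposition3 {k n : ℕ} (hkn : k < n) (Γ : SimpleGraph (Fin k))
    (E : Submodule ℝ (EuclideanSpace ℝ (Fin k))) (lam : ℝ)
    (hlam : Module.End.HasEigenvalue (Matrix.toEuclideanLin (PlantedSubgraph.adj Γ)) lam)
    (hE : E = Module.End.eigenspace (Matrix.toEuclideanLin (PlantedSubgraph.adj Γ)) lam)
    (p : ℝ) (hp0 : 0 ≤ p) (hp : p < (PlantedSubgraph.krank E : ℝ) / k)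
    {X : Type*} [MeasurableSpace X] (μ : Measure X) [IsProbabilityMeasure μ]
    (𝔊 : X → SimpleGraph (Fin n))
    (h𝔊 : PlantedSubgraph.IsPlantedErdosRenyi hkn Γ p μ 𝔊)
    (l : ℕ) (hkl : (k : ℝ) * p < l) (hl : l ≤ PlantedSubgraph.krank E)
    (δ : ℝ) (hδ : Real.sqrt (((n : ℝ) - k) * PlantedSubgraph.combWidth E l p) ≤ δ) :
    (1 - 2 * (k : ℝ) * Real.exp
        (-(3 * PlantedSubgraph.zeta E l
              * (δ ^ 2 - ((n : ℝ) - k) * PlantedSubgraph.combWidth E l p) ^ 2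
            / (4 * (l : ℝ)
              * (δ ^ 2 + 2 * ((n : ℝ) - k) * PlantedSubgraph.combWidth E l p)))))
      * (1 - Real.exp (-(((l : ℝ) - k * p) ^ 2 / (l + k * p)))) ^ (n - k)
    ≤ μ.real {x | ∃ M : Matrix (Fin k) (Fin (n - k)) ℝ,
        (∀ j, WithLp.toLp 2 (fun i => M i j) ∈ E) ∧
        (∀ i j, PlantedSubgraph.adj (𝔊 x)
              (PlantedSubgraph.coreNode hkn i) (PlantedSubgraph.outerNode hkn j) = 1 →
            M i j = PlantedSubgraph.adj (𝔊 x)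
              (PlantedSubgraph.coreNode hkn i) (PlantedSubgraph.outerNode hkn j)) ∧
        ‖M‖ < δ} := by
  have hk : 0 < k := by
    rcases Nat.eq_zero_or_pos k with rfl | h
    -- Division by zero gives `0`, so `k = 0` would force `p < 0`.
    · simp only [Nat.cast_zero, div_zero] at hp
      linarith
    · exact h
  have hk1 : (1 : ℝ) ≤ k := by exact_mod_cast hk
  have hp1 : p ≤ 1 := h𝔊.prob_le_one ⟨0, hk⟩
  have hl0 : (0 : ℝ) < l := (by positivity : 0 ≤ (k : ℝ) * p).trans_lt hkl
  have hN : ((n - k : ℕ) : ℝ) = (n : ℝ) - k := Nat.cast_sub hkn.le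
  have hω : 0 ≤ combWidth E l p := norm_nonneg _
  rw [← hN] at hδ ⊢
  have hNω : 0 ≤ ((n - k : ℕ) : ℝ) * combWidth E l p := by positivity
  have hexp : Real.exp (-(((l : ℝ) - k * p) ^ 2 / (l + k * p))) < 1 := by
    rw [Real.exp_lt_one_iff, neg_lt_zero]
    have : 0 < (l : ℝ) - k * p := sub_pos.2 hkl
    positivity
  have hpow := pow_nonneg (sub_pos.2 hexp).le (n - k)
  -- Since `k ≥ 1`, a nonnegative exponent makes the first factor negative and the bound vacuous.
  have htrivial : ∀ y : ℝ, 0 ≤ y → (1 - 2 * (k : ℝ) * Real.exp y)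
      * (1 - Real.exp (-(((l : ℝ) - k * p) ^ 2 / (l + k * p)))) ^ (n - k) ≤ 0 := by
    intro y hy
    refine mul_nonpos_of_nonpos_of_nonneg ?_ hpow
    nlinarith [Real.one_le_exp hy]
  have hδ0 : 0 ≤ δ := (Real.sqrt_nonneg _).trans hδ
  have hδ2 := (Real.sqrt_le_left hδ0).1 hδ
  rcases le_or_gt (zeta E l) 0 with hζ | hζ
  · refine (htrivial _ ?_).trans measureReal_nonneg
    rw [neg_nonneg]
    refine div_nonpos_of_nonpos_of_nonneg ?_ (by positivity)
    exact mul_nonpos_of_nonpos_of_nonneg (by linarith) (sq_nonneg _)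
  -- At equality the exponent is `0`, also when `δ = ω = 0`, where the quotient is `0 / 0 = 0`.
  rcases hδ2.eq_or_lt with heq | hlt
  · refine (htrivial _ ?_).trans measureReal_nonneg
    rw [heq]
    simp
  have hδpos : 0 < δ := hδ0.lt_of_ne fun h0 => by
    rw [← h0] at hlt
    simp only [ne_eq, OfNat.ofNat_ne_zero, not_false_eq_true, zero_pow] at hlt
    linarith
  have hch := one_sub_exp_le_sum_subsetWeight hp0 hp1 hkl
  have hZ := (sub_pos.2 hexp).trans_le hch
  have hmain := le_sum_prod_subsetWeight E hk (by exact_mod_cast hl0) hp0 hp1 hζ hZ (n - k)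
    hδpos hlt
  set e := Real.exp (-(3 * zeta E l * (δ ^ 2 - ((n - k : ℕ) : ℝ) * combWidth E l p) ^ 2
        / (4 * l * (δ ^ 2 + 2 * ((n - k : ℕ) : ℝ) * combWidth E l p)))) with he
  have he0 : 0 < e := Real.exp_pos _
  -- Replacing the second factor by the larger `Z ^ N` requires a nonnegative first factor;
  -- otherwise the bound is trivial.
  rcases le_or_gt (1 - 2 * (k : ℝ) * e) 0 with hneg | hpos
  · exact (mul_nonpos_of_nonpos_of_nonneg hneg hpow).trans measureReal_nonneg
  have hstep : 1 - 2 * (k : ℝ) * e ≤ 1 - k * e := by nlinarith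
  refine (mul_le_mul hstep (pow_le_pow_left₀ (sub_pos.2 hexp).le hch _) hpow
    (hpos.le.trans hstep)).trans (hmain.trans ?_)
  refine h𝔊.sum_prod_subsetWeight_le hp0 _ fun x hx => ?_
  obtain ⟨hcard, hnorm⟩ := (Finset.mem_filter.1 hx).2
  have hspec : ∀ j, minNormCompletion E (neighborSet hkn (𝔊 x) j)
      ∈ completions E (neighborSet hkn (𝔊 x) j) := fun j => by
    obtain ⟨q, hq, -⟩ := exists_completion E hζ (hcard j)
    exact (minNormCompletion_spec E ⟨q, hq⟩).1
  refine ⟨_, fun j => (hspec j).1, fun i j hij => ?_, hnorm⟩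
  rw [hij]
  refine (hspec j).2 i ?_
  simpa [neighborSet, adj, SimpleGraph.adjMatrix_apply] using hij
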